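/- Let $M$ be a smooth, Hausdorff, second countable manifold (finite-dimensional, without boundary) and let $E\to M$ be a smooth real vector bundle of finite nonzero rank. Write $\Gamma E$ for its space of smooth sections. A derivative endomorphism of $\Gamma E$ is an $\mathbb R$-linear map $D\colon\Gamma E\to\Gamma E$ for which there is an $\mathbb R$-linear map $D_M\colon C^\infty(M)\to C^\infty(M)$ with $$D(f\psi)=f\,D(\psi)+D_M(f)\,\psi\qquad\text{for all } f\in C^\infty(M),\ \psi\in\Gamma E .$$ Equivalently, $D$ is a linear differential operator of order at most one with scalar symbol, that is, $[[D,f],g]=0$ for all $f,g\in C^\infty(M)$ and, at every $x\in M$, $\sigma(D)(df)=[D,f]$ is a scalar multiple of $\mathrm{Id}_{E_x}$. A Lie algebroid over $M$ is a smooth vector bundle $A\to M$ of finite rank with a vector bundle morphism $a\colon A\to TM$ over $M$ (the anchor) and an $\mathbb R$-bilinear, alternating bracket on $\Gamma A$ that satisfies the Jacobi identity, $a([X,Y])=[a(X),a(Y)]$ and $[X,fY]=f[X,Y]+a(X)(f)\,Y$ for all $X,Y\in\Gamma A$, $f\in C^\infty(M)$. It is transitive if $a$ is surjective. **Theorem.**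 There is a transitive Lie algebroid $\mathfrak D(E)$ over $M$ whose smooth sections are exactly the derivative endomorphisms of $\Gamma E$: there is an isomorphism of $C^\infty(M)$-modules from $\Gamma\mathfrak D(E)$ onto the module of derivative endomorphisms of $\Gamma E$. Under this identification the bracket is the commutator $[D_1,D_2]=D_1\circ D_2-D_2\circ D_1$ and the anchor is $D\mapsto D_M$: for every section $D$, the map $D_M$ is unique and is the derivation of $C^\infty(M)$ given by the vector field $a(D)$. Moreover there is a short exact sequence of vector bundles over $M$, $$0\to \mathrm{End}(E)\to\mathfrak D(E)\xrightarrow{\ a\ }TM\to 0,$$ in which a section $u$ of $\mathrm{End}(E)$ is sent to the operator $\psi\mapsto u\psi$ on $\Gamma E$. -/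

import Mathlib

universe uB uH uM uF uE

open scoped Manifold ContDiff Bundle

noncomputable section

section Bundles

variable {EB : Type*} [NormedAddCommGroup EB] [NormedSpace ℝ EB]
  {H : Type*} [TopologicalSpace H] (I : ModelWithCorners ℝ EB H)
  {M : Type*} [TopologicalSpace M] [ChartedSpace H M]
  (F : Type*) [NormedAddCommGroup F] [NormedSpace ℝ F]
  (E : M → Type*) [TopologicalSpace (Bundle.TotalSpace F E)]
  [∀ x, TopologicalSpace (E x)] [∀ x, AddCommGroup (E x)] [∀ x, Module ℝ (E x)]
  [FiberBundle F E] [VectorBundle ℝ F E]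
  (F' : Type*) [NormedAddCommGroup F'] [NormedSpace ℝ F']
  (E' : M → Type*) [TopologicalSpace (Bundle.TotalSpace F' E')]
  [∀ x, TopologicalSpace (E' x)] [∀ x, AddCommGroup (E' x)] [∀ x, Module ℝ (E' x)]
  [FiberBundle F' E'] [VectorBundle ℝ F' E']

/-- A smooth morphism of vector bundles over the identity of `M`: a fibrewise linear map whose
total map is smooth. -/
structure VectorBundleHom where
  fiberMap : ∀ x : M, E x →ₗ[ℝ] E' x
  smooth : ContMDiff (I.prod 𝓘(ℝ, F)) (I.prod 𝓘(ℝ, F')) ∞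
    (fun p : Bundle.TotalSpace F E => Bundle.TotalSpace.mk' F' p.1 (fiberMap p.1 p.2))

variable {I F E F' E'}

/-- The action of a vector bundle morphism on smooth sections. -/
def VectorBundleHom.mapSection (φ : VectorBundleHom I F E F' E') (s : Cₛ^∞⟮I; F, E⟯) :
    Cₛ^∞⟮I; F', E'⟯ where
  toFun x := φ.fiberMap x (s x)
  contMDiff_toFun := φ.smooth.comp s.contMDiff

/-- The product `fψ` of a smooth function and a smooth section. -/
def funSmul (f : C^∞⟮I, M; ℝ⟯) (s : Cₛ^∞⟮I; F, E⟯) : Cₛ^∞⟮I; F, E⟯ where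
  toFun x := f x • s x
  contMDiff_toFun := f.contMDiff.smul_section s.contMDiff

/-- `D (fψ) = f D ψ + D_M(f) ψ` for all smooth functions `f` and all smooth sections `ψ`. -/
def IsDerivativeOver (D : Cₛ^∞⟮I; F, E⟯ →ₗ[ℝ] Cₛ^∞⟮I; F, E⟯)
    (DM : C^∞⟮I, M; ℝ⟯ →ₗ[ℝ] C^∞⟮I, M; ℝ⟯) : Prop :=
  ∀ (f : C^∞⟮I, M; ℝ⟯) (ψ : Cₛ^∞⟮I; F, E⟯),
    D (funSmul f ψ) = funSmul f (D ψ) + funSmul (DM f) ψ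

/-- Derivative endomorphisms of the space of smooth sections of `E`. -/
def IsDerivativeEndomorphism (D : Cₛ^∞⟮I; F, E⟯ →ₗ[ℝ] Cₛ^∞⟮I; F, E⟯) : Prop :=
  ∃ DM : C^∞⟮I, M; ℝ⟯ →ₗ[ℝ] C^∞⟮I, M; ℝ⟯, IsDerivativeOver D DM

/-- The commutator `[D, f]` of an operator on sections with multiplication by `f`. -/
def funCommutator (D : Cₛ^∞⟮I; F, E⟯ → Cₛ^∞⟮I; F, E⟯) (f : C^∞⟮I, M; ℝ⟯)
    (ψ : Cₛ^∞⟮I; F, E⟯) : Cₛ^∞⟮I; F, E⟯ :=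
  D (funSmul f ψ) - funSmul f (D ψ)

/-- Linear differential operators of order at most one: `[[D, f], g] = 0` for all smooth functions
`f` and `g`. -/
def IsFirstOrderDiffOp (D : Cₛ^∞⟮I; F, E⟯ →ₗ[ℝ] Cₛ^∞⟮I; F, E⟯) : Prop :=
  ∀ (f g : C^∞⟮I, M; ℝ⟯) (ψ : Cₛ^∞⟮I; F, E⟯), funCommutator (funCommutator D f) g ψ = 0

/-- The symbol `σ(D)(df) = [D, f]` is, at every point `x`, a scalar multiple of the identity of the
fibre `E x`. Every covector at `x` is of the form `df` at `x`. -/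
def HasScalarSymbol (D : Cₛ^∞⟮I; F, E⟯ →ₗ[ℝ] Cₛ^∞⟮I; F, E⟯) : Prop :=
  ∀ (f : C^∞⟮I, M; ℝ⟯) (x : M), ∃ c : ℝ, ∀ ψ : Cₛ^∞⟮I; F, E⟯,
    funCommutator D f ψ x = c • ψ x

variable (I F E) [IsManifold I ∞ M] [ContMDiffVectorBundle ∞ F E I]

/-- A Lie algebroid structure on the smooth vector bundle `E` over `M`. -/
structure LieAlgebroid where
  /-- the anchor, a vector bundle morphism to the tangent bundle -/
  anchor : VectorBundleHom I F E EB (TangentSpace I : M → Type _)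
  /-- the `ℝ`-bilinear bracket of smooth sections -/
  bracket : Cₛ^∞⟮I; F, E⟯ →ₗ[ℝ] Cₛ^∞⟮I; F, E⟯ →ₗ[ℝ] Cₛ^∞⟮I; F, E⟯
  bracket_self : ∀ X, bracket X X = 0
  jacobi : ∀ X Y Z, bracket X (bracket Y Z) + bracket Y (bracket Z X) + bracket Z (bracket X Y) = 0
  anchor_bracket : ∀ X Y, ∀ x, anchor.fiberMap x (bracket X Y x) =
    VectorField.mlieBracket I (fun y => anchor.fiberMap y (X y))
      (fun y => anchor.fiberMap y (Y y)) x
  leibniz : ∀ (X Y : Cₛ^∞⟮I; F, E⟯) (f : C^∞⟮I, M; ℝ⟯), ∀ x,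
    bracket X (funSmul f Y) x =
      f x • bracket X Y x + mvfderiv I f x (anchor.fiberMap x (X x)) • Y x

variable {I F E}

/-- A Lie algebroid is transitive if its anchor is surjective. -/
def LieAlgebroid.IsTransitive (L : LieAlgebroid I F E) : Prop :=
  ∀ x, Function.Surjective (L.anchor.fiberMap x)

end Bundles

end

noncomputable section

open Set Filter Topology Bundle

/-! ### Extension of local functions and sections by bump functions -/

section SmoothExtension

variable {EB : Type*} [NormedAddCommGroup EB] [NormedSpace ℝ EB]
  {H : Type*} [TopologicalSpace H] {I : ModelWithCorners ℝ EB H}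
  {M : Type*} [TopologicalSpace M] [ChartedSpace H M]
  {F : Type*} [NormedAddCommGroup F] [NormedSpace ℝ F]
  {E : M → Type*} [TopologicalSpace (TotalSpace F E)]
  [∀ x, TopologicalSpace (E x)] [∀ x, AddCommGroup (E x)] [∀ x, Module ℝ (E x)]
  [FiberBundle F E] [VectorBundle ℝ F E]

/-! A partition of unity provides a linear connection `∇` on `E`. It splits the bundle to be found,
so the underlying vector bundle can be taken to be `TM ⊕ End E`, with the section `(X, u)` acting as
the operator `∇_X + u`. The anchor is the first projection and the exact sequence is that of the
direct sum; only the bracket depends on `∇`.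

The point is that every derivative endomorphism `D` has this form. Since the rank is nonzero, some
section is nonzero at any given point, which makes `D_M` unique; expanding `D(fgψ)` in two ways
shows that `D_M` is a derivation of `C^∞(M)`. By Hadamard's lemma a derivation is a smooth vector
field `X` (`IsLeibniz.exists_vectorField`). Then `D` and `∇_X` have the same `D_M`, so `D - ∇_X` is
linear over `C^∞(M)`, hence a smooth section of `End E` (`exists_endomorphism_section`).

Conversely `(X, u)` is recovered from its operator: `X` from `D_M`, because functions separate
tangent vectors, and then `u` by evaluating on sections. A commutator of derivative endomorphisms is
again one, so the bracket is transported from operators, and bilinearity, the Jacobi identity and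
the Leibniz rule hold because they hold for operators. The anchor respects brackets because `D ↦
D_M` respects commutators and the Lie bracket of vector fields is the commutator of derivations. -/

@[simp] theorem funSmul_apply (f : C^∞⟮I, M; ℝ⟯) (s : Cₛ^∞⟮I; F, E⟯) (x : M) :
    funSmul f s x = f x • s x := rfl

@[simp] theorem ContMDiffSection.sum_apply {ι : Type*} (t : Finset ι) (s : ι → Cₛ^∞⟮I; F, E⟯)
    (x : M) : (∑ i ∈ t, s i) x = ∑ i ∈ t, s i x :=
  (congrFun (map_sum (ContMDiffSection.coeAddHom I F ∞ E) s t) x).trans (Finset.sum_apply _ _ _)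

/-- A section whose coordinates in a trivialization are smooth is smooth. -/
theorem contMDiffOn_trivialization_symm [ContMDiffVectorBundle ∞ F E I]
    (e : Trivialization F (TotalSpace.proj : TotalSpace F E → M)) [MemTrivializationAtlas e]
    {u : Set M} (hu : IsOpen u) (hue : u ⊆ e.baseSet)
    {w : M → F} (hw : ContMDiffOn I 𝓘(ℝ, F) ∞ w u) :
    ContMDiffOn I (I.prod 𝓘(ℝ, F)) ∞ (fun y => TotalSpace.mk' F y (e.symm y (w y))) u := by
  rw [e.contMDiffOn_section_iff hu hue]
  refine hw.congr fun y hy => ?_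
  change (e (TotalSpace.mk' F y (e.symm y (w y)))).2 = w y
  rw [e.apply_mk_symm (hue hy)]

variable [FiniteDimensional ℝ EB] [IsManifold I ∞ M] [T2Space M]

variable (I) in
theorem exists_contMDiffMap_eventually_one {x : M} {u : Set M} (hu : u ∈ 𝓝 x) :
    ∃ χ : C^∞⟮I, M; ℝ⟯, (∀ᶠ y in 𝓝 x, χ y = 1) ∧ tsupport χ ⊆ u := by
  obtain ⟨f, -, hf⟩ := (SmoothBumpFunction.nhds_basis_tsupport (I := I) x).mem_iff.1 hu
  exact ⟨⟨f, f.contMDiff⟩, f.eventuallyEq_one, hf⟩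

/-- A section which is smooth near `x` agrees near `x` with a global smooth section. -/
theorem exists_section_eventuallyEq {x : M} {u : Set M} (hu : u ∈ 𝓝 x) {σ : ∀ x, E x}
    (hσ : ContMDiffOn I (I.prod 𝓘(ℝ, F)) ∞ (fun y => TotalSpace.mk' F y (σ y)) u) :
    ∃ s : Cₛ^∞⟮I; F, E⟯, ∀ᶠ y in 𝓝 x, s y = σ y := by
  obtain ⟨v, hvu, hvo, hxv⟩ := mem_nhds_iff.1 hu
  obtain ⟨χ, h1, hs⟩ := exists_contMDiffMap_eventually_one I (hvo.mem_nhds hxv)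
  refine ⟨⟨fun y => χ y • σ y,
    χ.contMDiff.contMDiffOn.smul_section_of_tsupport hvo hs (hσ.mono hvu)⟩, ?_⟩
  filter_upwards [h1] with y hy
  change χ y • σ y = σ y
  rw [hy, one_smul]

/-- A function which is smooth near `x` agrees near `x` with a global smooth function. -/
theorem exists_contMDiffMap_eventuallyEq {x : M} {u : Set M} (hu : u ∈ 𝓝 x) {g : M → ℝ}
    (hg : ContMDiffOn I 𝓘(ℝ, ℝ) ∞ g u) :
    ∃ f : C^∞⟮I, M; ℝ⟯, ∀ᶠ y in 𝓝 x, f y = g y := by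
  obtain ⟨v, hvu, hvo, hxv⟩ := mem_nhds_iff.1 hu
  obtain ⟨χ, h1, hs⟩ := exists_contMDiffMap_eventually_one I (hvo.mem_nhds hxv)
  refine ⟨⟨fun y => χ y * g y, contMDiff_of_tsupport fun y hy => ?_⟩, ?_⟩
  · have hy' : y ∈ v := hs (closure_mono (Function.support_mul_subset_left _ _) hy)
    exact χ.contMDiff.contMDiffAt.mul ((hg.mono hvu).contMDiffAt (hvo.mem_nhds hy'))
  · filter_upwards [h1] with y hy
    change χ y * g y = g y
    rw [hy, one_mul]

variable [ContMDiffVectorBundle ∞ F E I]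

/-- Every vector is the value of a global smooth section. -/
theorem exists_section_apply_eq (x : M) (v : E x) : ∃ s : Cₛ^∞⟮I; F, E⟯, s x = v := by
  set e := trivializationAt F E x
  have hx : x ∈ e.baseSet := mem_baseSet_trivializationAt F E x
  obtain ⟨s, hs⟩ := exists_section_eventuallyEq (e.open_baseSet.mem_nhds hx)
    (contMDiffOn_trivialization_symm (I := I) e e.open_baseSet subset_rfl
      (w := fun _ => (e ⟨x, v⟩).2) contMDiffOn_const)
  exact ⟨s, by rw [hs.self_of_nhds]; exact e.symm_apply_apply_mk hx v⟩

/-- Nonzero rank enters through this lemma: a scalar acting on the values of sections at `x` is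
determined by its action on one nonzero value. -/
theorem exists_section_ne_zero [Nontrivial F] (x : M) : ∃ s : Cₛ^∞⟮I; F, E⟯, s x ≠ 0 := by
  set e := trivializationAt F E x
  have hx : x ∈ e.baseSet := mem_baseSet_trivializationAt F E x
  obtain ⟨w, hw⟩ := exists_ne (0 : F)
  obtain ⟨s, hs⟩ := exists_section_apply_eq (I := I) (F := F) x (e.symm x w)
  refine ⟨s, fun h => hw ?_⟩
  rw [h] at hs
  have := (e.continuousLinearEquivAt ℝ x hx).symm.map_eq_zero_iff.1 (show _ = 0 from hs.symm)
  exact this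

/-- Near every point, a section is a combination of a fixed finite family of global sections,
with global smooth functions as coefficients. -/
theorem exists_frame [FiniteDimensional ℝ F] (x : M) :
    ∃ s : Fin (Module.finrank ℝ F) → Cₛ^∞⟮I; F, E⟯, ∀ ψ : Cₛ^∞⟮I; F, E⟯,
      ∃ c : Fin (Module.finrank ℝ F) → C^∞⟮I, M; ℝ⟯,
        (∀ᶠ y in 𝓝 x, ψ y = (∑ i, funSmul (c i) (s i)) y) ∧ (ψ x = 0 → ∀ i, c i x = 0) := by
  set e := trivializationAt F E x
  have hx : x ∈ e.baseSet := mem_baseSet_trivializationAt F E x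
  let b := Module.finBasis ℝ F
  have h1 : ∀ i, ∃ s : Cₛ^∞⟮I; F, E⟯, ∀ᶠ y in 𝓝 x, s y = e.symm y (b i) := fun i =>
    exists_section_eventuallyEq (e.open_baseSet.mem_nhds hx)
      (contMDiffOn_trivialization_symm (I := I) e e.open_baseSet subset_rfl contMDiffOn_const)
  choose s hs using h1
  refine ⟨s, fun ψ => ?_⟩
  have h2 : ∀ i, ∃ c : C^∞⟮I, M; ℝ⟯, ∀ᶠ y in 𝓝 x, c y = b.coord i (e ⟨y, ψ y⟩).2 := fun i => by
    refine exists_contMDiffMap_eventuallyEq (e.open_baseSet.mem_nhds hx) ?_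
    have h := (e.contMDiffOn_section_baseSet_iff (IB := I) (n := ∞)).1 ψ.contMDiff.contMDiffOn
    exact ((b.coord i).toContinuousLinearMap.contDiff.contMDiff).comp_contMDiffOn h
  choose c hc using h2
  refine ⟨c, ?_, fun h0 i => ?_⟩
  · filter_upwards [eventually_all.2 hs, eventually_all.2 hc, e.open_baseSet.mem_nhds hx]
      with y hsy hcy hy
    simp only [ContMDiffSection.sum_apply, funSmul_apply]
    simp only [hsy, hcy]
    have h4 := (e.continuousLinearEquivAt ℝ y hy).symm_apply_apply (ψ y)
    have h5 := b.sum_repr (e.continuousLinearEquivAt ℝ y hy (ψ y))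
    rw [← h5, map_sum] at h4
    simp only [map_smul] at h4
    exact h4.symm
  · rw [(hc i).self_of_nhds, h0]
    have := (e.linear ℝ hx).map_zero
    rw [this, map_zero]

end SmoothExtension

/-! ### Hadamard's lemma -/

section Hadamard

open MeasureTheory

universe u

/-- An integral over `[0, 1]` depending smoothly on a parameter is smooth. -/
theorem contDiff_nat_integral_zero_one {V : Type u} [NormedAddCommGroup V] [NormedSpace ℝ V]
    [FiniteDimensional ℝ V] (n : ℕ) :
    ∀ {W : Type u} [NormedAddCommGroup W] [NormedSpace ℝ W] [CompleteSpace W] {h : V × ℝ → W},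
      ContDiff ℝ n h → ContDiff ℝ n (fun y => ∫ t in (0 : ℝ)..1, h (y, t)) := by
  induction n with
  | zero =>
    intro W _ _ _ h hh
    rw [Nat.cast_zero, contDiff_zero] at hh ⊢
    exact intervalIntegral.continuous_parametric_intervalIntegral_of_continuous'
      (f := fun y t => h (y, t)) hh 0 1
  | succ n ih =>
    intro W _ _ _ h hh
    rw [Nat.cast_succ] at hh
    -- The partial derivative in the parameter takes values in `V →L[ℝ] W`; this is why the
    -- induction runs over all targets `W`.
    have h1 : ContDiff ℝ n (fun p : V × ℝ => (fderiv ℝ h p).comp (.inl ℝ V ℝ)) :=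
      (hh.fderiv_right le_rfl).clm_comp contDiff_const
    have hdiff : Differentiable ℝ h := hh.differentiable (by simp)
    rw [Nat.cast_succ, contDiff_succ_iff_hasFDerivAt]
    refine ⟨_, ih h1, fun y => ?_⟩
    -- Compactness bounds the derivative by a constant, which serves as the dominating function for
    -- differentiation under the integral.
    obtain ⟨C, hC⟩ := ((isCompact_closedBall y 1).prod (isCompact_Icc (a := (0 : ℝ)) (b := 1))
      ).exists_bound_of_continuousOn h1.continuous.continuousOn
    refine intervalIntegral.hasFDerivAt_integral_of_dominated_of_fderiv_le
      (F := fun x t => h (x, t)) (F' := fun x t => (fderiv ℝ h (x, t)).comp (.inl ℝ V ℝ))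
      (bound := fun _ => C) (Metric.closedBall_mem_nhds y one_pos) ?_ ?_ ?_ ?_ ?_ ?_
    · exact .of_forall fun x => (hdiff.continuous.comp (by fun_prop)).aestronglyMeasurable
    · exact (hdiff.continuous.comp (by fun_prop)).intervalIntegrable _ _
    · exact (h1.continuous.comp (by fun_prop : Continuous fun t : ℝ => (y, t))
        ).aestronglyMeasurable
    · refine .of_forall fun t ht x hx => hC (x, t) ⟨hx, ?_⟩
      rw [uIoc_of_le zero_le_one] at ht
      exact ⟨ht.1.le, ht.2⟩
    · exact intervalIntegrable_const
    · exact .of_forall fun t _ x _ =>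
        (hdiff (x, t)).hasFDerivAt.comp x (hasFDerivAt_prodMk_left x t)

/-- Hadamard's lemma. -/
theorem exists_contDiff_eq_add_apply_sub {V : Type u} [NormedAddCommGroup V] [NormedSpace ℝ V]
    [FiniteDimensional ℝ V] {f : V → ℝ} (hf : ContDiff ℝ ∞ f) (a : V) :
    ∃ G : V → V →L[ℝ] ℝ, ContDiff ℝ ∞ G ∧ G a = fderiv ℝ f a ∧
      ∀ y, f y = f a + G y (y - a) := by
  have hd : Differentiable ℝ f := hf.differentiable (by simp)
  have hf' : ContDiff ℝ ∞ (fderiv ℝ f) := hf.fderiv_right (by simp)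
  have hp : ContDiff ℝ ∞ (fun p : V × ℝ => fderiv ℝ f (a + p.2 • (p.1 - a))) :=
    hf'.comp (by fun_prop)
  refine ⟨fun y => ∫ t in (0 : ℝ)..1, fderiv ℝ f (a + t • (y - a)), ?_, by simp, fun y => ?_⟩
  · rw [contDiff_infty] at hp ⊢
    exact fun n => contDiff_nat_integral_zero_one n (hp n)
  · have hline : ∀ t : ℝ, HasDerivAt (fun s : ℝ => a + s • (y - a)) (y - a) t := fun t => by
      simpa using ((hasDerivAt_id t).smul_const (y - a)).const_add a
    have hc : Continuous fun t : ℝ => fderiv ℝ f (a + t • (y - a)) :=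
      hf'.continuous.comp (by fun_prop)
    have h := intervalIntegral.integral_eq_sub_of_hasDerivAt (a := (0 : ℝ)) (b := 1)
      (fun t _ => (hd _).hasFDerivAt.comp_hasDerivAt t (hline t))
      ((hc.clm_apply continuous_const).intervalIntegrable _ _)
    rw [ContinuousLinearMap.intervalIntegral_apply (hc.intervalIntegrable _ _), h]
    simp

end Hadamard

/-! ### Derivations of smooth functions are vector fields -/

section Derivations

variable {EB : Type*} [NormedAddCommGroup EB] [NormedSpace ℝ EB]
  {H : Type*} [TopologicalSpace H] {I : ModelWithCorners ℝ EB H}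
  {M : Type*} [TopologicalSpace M] [ChartedSpace H M]

/-- The Leibniz rule for operators on smooth functions. -/
def IsLeibniz (δ : C^∞⟮I, M; ℝ⟯ →ₗ[ℝ] C^∞⟮I, M; ℝ⟯) : Prop :=
  ∀ f g x, δ (f * g) x = f x * δ g x + g x * δ f x

theorem IsLeibniz.map_const {δ : C^∞⟮I, M; ℝ⟯ →ₗ[ℝ] C^∞⟮I, M; ℝ⟯} (hδ : IsLeibniz δ) (r : ℝ)
    (x : M) : δ (r • 1) x = 0 := by
  have h := hδ 1 1 x
  rw [mul_one] at h
  have h1 : (1 : C^∞⟮I, M; ℝ⟯) x = 1 := rfl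
  rw [h1] at h
  rw [map_smul]
  change r * δ 1 x = 0
  rw [show δ 1 x = 0 by linarith, mul_zero]

variable [FiniteDimensional ℝ EB] [IsManifold I ∞ M] [T2Space M]

/-- Derivations are local: for a bump function `χ` equal to 1 near `x` and supported where `f = g`,
apply the Leibniz rule at `x` to `χ * (f - g) = 0`. -/
theorem IsLeibniz.congr {δ : C^∞⟮I, M; ℝ⟯ →ₗ[ℝ] C^∞⟮I, M; ℝ⟯} (hδ : IsLeibniz δ)
    {f g : C^∞⟮I, M; ℝ⟯} {x : M} (hfg : ∀ᶠ y in 𝓝 x, f y = g y) : δ f x = δ g x := by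
  obtain ⟨χ, h1, hs⟩ := exists_contMDiffMap_eventually_one I hfg
  have h0 : χ * (f - g) = 0 := by
    ext y
    change χ y * (f y - g y) = 0
    by_cases hy : y ∈ tsupport χ
    · rw [sub_eq_zero.2 (hs hy), mul_zero]
    · rw [image_eq_zero_of_notMem_tsupport hy, zero_mul]
  have h := hδ χ (f - g) x
  have h2 : (f - g) x = 0 := sub_eq_zero.2 hfg.self_of_nhds
  rw [h0, h1.self_of_nhds, h2, map_zero, map_sub] at h
  have h3 : (0 : ℝ) = 1 * (δ f x - δ g x) + 0 * δ χ x := h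
  linarith

variable (I) in
/-- The coordinates centred at `x`, extended to global smooth functions. -/
theorem exists_coordinates {ι : Type*} [Finite ι] (b : Module.Basis ι ℝ EB) (x : M) :
    ∃ c : ι → C^∞⟮I, M; ℝ⟯, ∀ i, ∀ᶠ y in 𝓝 x,
      c i y = b.coord i (extChartAt I x y - extChartAt I x x) := by
  have h : ∀ i, ∃ c : C^∞⟮I, M; ℝ⟯, ∀ᶠ y in 𝓝 x,
      c y = b.coord i (extChartAt I x y - extChartAt I x x) := fun i => by
    refine exists_contMDiffMap_eventuallyEq (chart_source_mem_nhds H x) ?_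
    exact ((b.coord i).toContinuousLinearMap.contDiff.contMDiff).comp_contMDiffOn
      ((contDiff_id.sub contDiff_const).contMDiff.comp_contMDiffOn
        (contMDiffOn_extChartAt (I := I)))
  choose c hc using h
  exact ⟨c, hc⟩

variable [I.Boundaryless]

/-- First order expansion of a smooth function in the coordinates at `x`, with smooth
coefficients. -/
theorem exists_eventuallyEq_sum_mul_coordinates {ι : Type*} [Fintype ι]
    (b : Module.Basis ι ℝ EB) {x : M} {c : ι → C^∞⟮I, M; ℝ⟯}
    (hc : ∀ i, ∀ᶠ y in 𝓝 x, c i y = b.coord i (extChartAt I x y - extChartAt I x x))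
    (f : C^∞⟮I, M; ℝ⟯) :
    ∃ g : ι → C^∞⟮I, M; ℝ⟯, (∀ i, g i x = mvfderiv I f x (b i : EB)) ∧
      ∀ᶠ y in 𝓝 x, f y = f x + ∑ i, g i y * c i y := by
  set φ := extChartAt I x
  have htgt : φ.target ∈ 𝓝 (φ x) := extChartAt_target_mem_nhds x
  -- The chart expression of `f` is smooth only on the chart target. Replacing it by a function on
  -- all of `EB` with the same germ lets Hadamard's lemma apply without a star-shaped domain.
  obtain ⟨F, hF⟩ := exists_contMDiffMap_eventuallyEq (I := 𝓘(ℝ, EB)) htgt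
    (f.contMDiff.comp_contMDiffOn (contMDiffOn_extChartAt_symm x))
  obtain ⟨G, hG, hGx, hFG⟩ := exists_contDiff_eq_add_apply_sub F.contMDiff.contDiff (φ x)
  have h : ∀ i, ∃ g : C^∞⟮I, M; ℝ⟯, ∀ᶠ y in 𝓝 x, g y = G (φ y) (b i) := fun i => by
    refine exists_contMDiffMap_eventuallyEq (chart_source_mem_nhds H x) ?_
    exact (hG.clm_apply contDiff_const).contMDiff.comp_contMDiffOn contMDiffOn_extChartAt
  choose g hg using h
  have hφ : Tendsto φ (𝓝 x) (𝓝 (φ x)) := (continuousAt_extChartAt x)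
  have hfF : ∀ᶠ y in 𝓝 x, f y = F (φ y) := by
    filter_upwards [hφ.eventually hF, extChartAt_source_mem_nhds (I := I) x] with y hy hys
    rw [hy, Function.comp_apply, φ.left_inv hys]
  refine ⟨g, fun i => ?_, ?_⟩
  · have hm : mfderiv I 𝓘(ℝ, ℝ) f x = fderiv ℝ F (φ x) := by
      rw [(f.mdifferentiableAt (x := x)).mfderiv, I.range_eq_univ, fderivWithin_univ]
      refine Filter.EventuallyEq.fderiv_eq ?_
      filter_upwards [hF] with z hz
      exact hz.symm
    rw [(hg i).self_of_nhds, hGx, ← hm]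
    rfl
  · filter_upwards [hfF, eventually_all.2 hg, eventually_all.2 hc] with y h1 h2 h3
    rw [h1, hFG, hfF.self_of_nhds]
    congr 1
    conv_lhs => rw [← b.sum_repr (φ y - φ x), map_sum]
    refine Finset.sum_congr rfl fun i _ => ?_
    rw [map_smul, h2, h3, smul_eq_mul, mul_comm]
    rfl

/-- Apply `δ` to the Hadamard expansion `f = f(x) + ∑ g_i c_i`: constants are killed, and since
`c_i(x) = 0` only `g_i(x) δ(c_i)(x)` survives, where `g_i(x)` is a partial derivative of `f`. -/
theorem IsLeibniz.eq_sum {δ : C^∞⟮I, M; ℝ⟯ →ₗ[ℝ] C^∞⟮I, M; ℝ⟯} (hδ : IsLeibniz δ)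
    {ι : Type*} [Fintype ι] (b : Module.Basis ι ℝ EB) {x : M} {c : ι → C^∞⟮I, M; ℝ⟯}
    (hc : ∀ i, ∀ᶠ y in 𝓝 x, c i y = b.coord i (extChartAt I x y - extChartAt I x x))
    (f : C^∞⟮I, M; ℝ⟯) :
    δ f x = mvfderiv I f x (∑ i, δ (c i) x • b i : EB) := by
  obtain ⟨g, hg, hfg⟩ := exists_eventuallyEq_sum_mul_coordinates b hc f
  have h1 : δ f x = δ (f x • 1 + ∑ i, g i * c i) x := by
    refine hδ.congr ?_
    filter_upwards [hfg] with y hy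
    rw [hy]
    have h2 : (∑ i, g i * c i) y = ∑ i, g i y * c i y :=
      (congrFun (map_sum ContMDiffMap.coeFnAddMonoidHom (fun i => g i * c i) .univ) y).trans
        (Finset.sum_apply _ _ _)
    change _ = f x • (1 : ℝ) + (∑ i, g i * c i) y
    rw [h2, smul_eq_mul, mul_one]
  have h3 : δ f x = δ (f x • 1) x + ∑ i, δ (g i * c i) x := by
    rw [h1, map_add, map_sum]
    change _ + (∑ i, δ (g i * c i)) x = _
    congr 1
    exact (congrFun (map_sum ContMDiffMap.coeFnAddMonoidHom (fun i => δ (g i * c i)) .univ)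
      x).trans (Finset.sum_apply _ _ _)
  rw [h3, hδ.map_const, zero_add]
  refine Eq.trans ?_ (map_sum (mvfderiv I f x) (fun i => (δ (c i) x • b i : EB)) .univ).symm
  refine Finset.sum_congr rfl fun i _ => ?_
  refine Eq.trans ?_ ((mvfderiv I f x).map_smul (δ (c i) x) (b i : EB)).symm
  rw [hδ, (hc i).self_of_nhds, sub_self, map_zero, zero_mul, add_zero, hg, smul_eq_mul, mul_comm]

/-- Every derivation of the algebra of smooth functions is given by a smooth vector field. -/
theorem IsLeibniz.exists_vectorField {δ : C^∞⟮I, M; ℝ⟯ →ₗ[ℝ] C^∞⟮I, M; ℝ⟯} (hδ : IsLeibniz δ) :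
    ∃ X : Cₛ^∞⟮I; EB, (TangentSpace I : M → Type _)⟯, ∀ f x, δ f x = mvfderiv I f x (X x) := by
  let b := Module.finBasis ℝ EB
  choose c hc using fun x : M => exists_coordinates I b x
  let X : ∀ x : M, TangentSpace I x := fun x => (∑ i, δ (c x i) x • b i : EB)
  have hX : ∀ f x, δ f x = mvfderiv I f x (X x) := fun f x => hδ.eq_sum b (hc x) f
  refine ⟨⟨X, fun x => ?_⟩, hX⟩
  rw [contMDiffAt_section]
  -- Near `x` the functions `c x i` differ from the chart coordinates by constants, so the
  -- components of `X y` are `X y` applied to them. These are smooth in `y` because `δ` takes values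
  -- in smooth functions.
  have h1 : ∀ᶠ y in 𝓝 x, (trivializationAt EB (TangentSpace I) x ⟨y, X y⟩).2 =
      ∑ i, δ (c x i) y • b i := by
    filter_upwards [chart_source_mem_nhds H x,
      eventually_all.2 fun i => (hc x i).eventually_nhds] with y hy hcy
    have h2 : (trivializationAt EB (TangentSpace I) x ⟨y, X y⟩).2 =
        (mfderiv I 𝓘(ℝ, EB) (extChartAt I x) y (X y) : EB) := by
      rw [← TangentBundle.continuousLinearMapAt_trivializationAt hy]
      exact (congrFun ((trivializationAt EB (TangentSpace I) x).coe_linearMapAt_of_mem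
        (R := ℝ) hy) (X y)).symm
    rw [h2, ← b.sum_repr (mfderiv I 𝓘(ℝ, EB) (extChartAt I x) y (X y) : EB)]
    refine Finset.sum_congr rfl fun i _ => ?_
    congr 1
    rw [hX]
    let ℓ : EB → ℝ := fun z => b.coord i (z - extChartAt I x x)
    have hℓ : HasFDerivAt ℓ (b.coord i).toContinuousLinearMap (extChartAt I x y) :=
      (b.coord i).toContinuousLinearMap.hasFDerivAt.comp (extChartAt I x y)
        ((hasFDerivAt_id _).sub_const _)
    have h3 : mfderiv I 𝓘(ℝ, ℝ) (c x i) y = mfderiv I 𝓘(ℝ, ℝ) (ℓ ∘ extChartAt I x) y :=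
      Filter.EventuallyEq.mfderiv_eq (hcy i)
    have h4 := mfderiv_comp (I' := 𝓘(ℝ, EB)) y hℓ.differentiableAt.mdifferentiableAt
      (mdifferentiableAt_extChartAt hy)
    have h5 : mfderiv 𝓘(ℝ, EB) 𝓘(ℝ, ℝ) ℓ (extChartAt I x y) =
        (b.coord i).toContinuousLinearMap := by
      rw [mfderiv_eq_fderiv]; exact hℓ.fderiv
    have h6 : mvfderiv I (c x i) y (X y) = mfderiv I 𝓘(ℝ, ℝ) (c x i) y (X y) := rfl
    rw [h6, h3, h4, h5]
    rfl
  refine ContMDiffAt.congr_of_eventuallyEq ?_ h1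
  refine contMDiffAt_finsetSum fun i _ => ?_
  exact (δ (c x i)).contMDiff.contMDiffAt.smul contMDiffAt_const

end Derivations

/-! ### Existence of a linear connection -/

section Connection

variable {EB : Type*} [NormedAddCommGroup EB] [NormedSpace ℝ EB]
  {H : Type*} [TopologicalSpace H] {I : ModelWithCorners ℝ EB H}
  {M : Type*} [TopologicalSpace M] [ChartedSpace H M]
  {F : Type*} [NormedAddCommGroup F] [NormedSpace ℝ F]
  {E : M → Type*} [TopologicalSpace (TotalSpace F E)]
  [∀ x, TopologicalSpace (E x)] [∀ x, AddCommGroup (E x)] [∀ x, Module ℝ (E x)]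
  [FiberBundle F E] [VectorBundle ℝ F E]

theorem Filter.EventuallyEq.mvfderiv_eq {g g' : M → F} {x : M} (h : g =ᶠ[𝓝 x] g') :
    mvfderiv I g x = mvfderiv I g' x := by
  ext v
  have h1 : mvfderiv I g x v = mfderiv I 𝓘(ℝ, F) g x v := rfl
  have h2 : mvfderiv I g' x v = mfderiv I 𝓘(ℝ, F) g' x v := rfl
  rw [h1, h2, h.mfderiv_eq]
  rfl

/-- The flat derivative of a section in a trivialization. -/
def localDeriv (e : Trivialization F (TotalSpace.proj : TotalSpace F E → M))
    [MemTrivializationAtlas e] (ψ : Cₛ^∞⟮I; F, E⟯) (x : M) : TangentSpace I x →ₗ[ℝ] E x :=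
  ((e.symmL ℝ x).comp (mvfderiv I (fun y => (e ⟨y, ψ y⟩).2) x)).toLinearMap

section

variable [ContMDiffVectorBundle ∞ F E I]
  {e : Trivialization F (TotalSpace.proj : TotalSpace F E → M)} [MemTrivializationAtlas e]

theorem contMDiffOn_snd_trivialization (ψ : Cₛ^∞⟮I; F, E⟯) :
    ContMDiffOn I 𝓘(ℝ, F) ∞ (fun y => (e ⟨y, ψ y⟩).2) e.baseSet :=
  e.contMDiffOn_section_baseSet_iff.1 ψ.contMDiff.contMDiffOn

theorem mdifferentiableAt_snd_trivialization (ψ : Cₛ^∞⟮I; F, E⟯) {x : M} (hx : x ∈ e.baseSet) :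
    MDifferentiableAt I 𝓘(ℝ, F) (fun y => (e ⟨y, ψ y⟩).2) x :=
  ((contMDiffOn_snd_trivialization ψ).contMDiffAt
    (e.open_baseSet.mem_nhds hx)).mdifferentiableAt (by simp)

theorem localDeriv_add (ψ ψ' : Cₛ^∞⟮I; F, E⟯) {x : M} (hx : x ∈ e.baseSet) :
    localDeriv e (ψ + ψ') x = localDeriv e ψ x + localDeriv e ψ' x := by
  have h : (fun y => (e ⟨y, (ψ + ψ') y⟩).2) =ᶠ[𝓝 x]
      (fun y => (e ⟨y, ψ y⟩).2) + fun y => (e ⟨y, ψ' y⟩).2 := by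
    filter_upwards [e.open_baseSet.mem_nhds hx] with y hy
    exact (e.linear ℝ hy).map_add _ _
  ext v
  change e.symmL ℝ x (mvfderiv I _ x v) = e.symmL ℝ x (mvfderiv I _ x v) +
    e.symmL ℝ x (mvfderiv I _ x v)
  rw [h.mvfderiv_eq, mvfderiv_add (mdifferentiableAt_snd_trivialization ψ hx)
    (mdifferentiableAt_snd_trivialization ψ' hx), ← map_add]
  rfl

theorem localDeriv_funSmul (f : C^∞⟮I, M; ℝ⟯) (ψ : Cₛ^∞⟮I; F, E⟯) {x : M} (hx : x ∈ e.baseSet)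
    (v : TangentSpace I x) :
    localDeriv e (funSmul f ψ) x v = f x • localDeriv e ψ x v + mvfderiv I f x v • ψ x := by
  have h : (fun y => (e ⟨y, funSmul f ψ y⟩).2) =ᶠ[𝓝 x] ⇑f • fun y => (e ⟨y, ψ y⟩).2 := by
    filter_upwards [e.open_baseSet.mem_nhds hx] with y hy
    exact (e.linear ℝ hy).map_smul _ _
  change e.symmL ℝ x (mvfderiv I _ x v) = f x • e.symmL ℝ x (mvfderiv I _ x v) + _
  rw [h.mvfderiv_eq, mvfderiv_smul f.mdifferentiableAt
    (mdifferentiableAt_snd_trivialization ψ hx)]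
  have h1 : e.symmL ℝ x (e ⟨x, ψ x⟩).2 = ψ x :=
    (e.symmL_apply hx _).trans (e.symm_apply_apply_mk hx (ψ x))
  have h2 : ∀ (a b : ℝ) (w w' : F), e.symmL ℝ x (a • w + b • w') =
      a • e.symmL ℝ x w + b • e.symmL ℝ x w' := fun a b w w' => by
    rw [map_add, map_smul, map_smul]
  conv_rhs => rw [← h1]
  exact h2 _ _ _ _

end

variable [IsManifold I ∞ M]

/-- The derivative of a smooth function along a smooth vector field is smooth. -/
theorem contMDiffOn_mvfderiv_apply {g : M → F} {u : Set M} (hu : IsOpen u)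
    (hg : ContMDiffOn I 𝓘(ℝ, F) ∞ g u) (X : Cₛ^∞⟮I; EB, (TangentSpace I : M → Type _)⟯) :
    ContMDiffOn I 𝓘(ℝ, F) ∞ (fun y => mvfderiv I g y (X y)) u := by
  have : IsManifold I 1 M := .of_le (n := ∞) (by simp)
  have h1 := hg.contMDiffOn_tangentMapWithin (m := ∞) (by simp) hu.uniqueMDiffOn
  have h2 : ContMDiffOn I 𝓘(ℝ, F).tangent ∞
      (fun y => tangentMapWithin I 𝓘(ℝ, F) g u ⟨y, X y⟩) u :=
    h1.comp X.contMDiff.contMDiffOn fun y hy => hy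
  have h3 := (contMDiff_snd_tangentBundle_modelSpace F 𝓘(ℝ, F) (n := ∞)).comp_contMDiffOn h2
  refine h3.congr fun y hy => ?_
  change mfderiv I 𝓘(ℝ, F) g y (X y) = mfderivWithin I 𝓘(ℝ, F) g u y (X y)
  rw [mfderivWithin_of_isOpen hu hy]

/-- The derivative of a smooth function along a smooth vector field. -/
def vectorFieldDeriv (X : Cₛ^∞⟮I; EB, (TangentSpace I : M → Type _)⟯) :
    C^∞⟮I, M; ℝ⟯ →ₗ[ℝ] C^∞⟮I, M; ℝ⟯ where
  toFun f := ⟨fun y => mvfderiv I f y (X y),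
    contMDiffOn_univ.1 (contMDiffOn_mvfderiv_apply isOpen_univ f.contMDiff.contMDiffOn X)⟩
  map_add' f g := by
    ext y
    have := mvfderiv_add (f.mdifferentiableAt (x := y)) (g.mdifferentiableAt (x := y))
    exact DFunLike.congr_fun this (X y)
  map_smul' r f := by
    ext y
    have h := mvfderiv_smul (mdifferentiableAt_const (c := r)) (f.mdifferentiableAt (x := y))
    refine (DFunLike.congr_fun h (X y)).trans ?_
    rw [mvfderiv_const]
    change r * mvfderiv I f y (X y) + 0 * f y = r * mvfderiv I f y (X y)
    ring

variable (I F E) in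
/-- A linear connection on the vector bundle `E`. -/
structure LinearConnection where
  toFun : Cₛ^∞⟮I; F, E⟯ → ∀ x, TangentSpace I x →ₗ[ℝ] E x
  map_add : ∀ ψ ψ' x, toFun (ψ + ψ') x = toFun ψ x + toFun ψ' x
  leibniz : ∀ (f : C^∞⟮I, M; ℝ⟯) ψ x v,
    toFun (funSmul f ψ) x v = f x • toFun ψ x v + mvfderiv I f x v • ψ x
  contMDiff : ∀ ψ (X : Cₛ^∞⟮I; EB, (TangentSpace I : M → Type _)⟯),
    ContMDiff I (I.prod 𝓘(ℝ, F)) ∞ (fun y => TotalSpace.mk' F y (toFun ψ y (X y)))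

/-- This is the Leibniz rule for a constant function, whose differential vanishes. -/
theorem LinearConnection.map_smul (cov : LinearConnection I F E) (r : ℝ) (ψ : Cₛ^∞⟮I; F, E⟯)
    (x : M) : cov.toFun (r • ψ) x = r • cov.toFun ψ x := by
  ext v
  have h := cov.leibniz ⟨fun _ => r, contMDiff_const⟩ ψ x v
  have h1 : mvfderiv I (fun _ : M => r) x = 0 := mvfderiv_const r
  change cov.toFun (r • ψ) x v = r • cov.toFun ψ x v + mvfderiv I (fun _ : M => r) x v • ψ x at h
  rw [h, h1]
  change _ + (0 : ℝ) • ψ x = _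
  rw [zero_smul, add_zero]
  rfl

variable [ContMDiffVectorBundle ∞ F E I]

variable {e : Trivialization F (TotalSpace.proj : TotalSpace F E → M)} [MemTrivializationAtlas e]

theorem contMDiffOn_localDeriv (ψ : Cₛ^∞⟮I; F, E⟯)
    (X : Cₛ^∞⟮I; EB, (TangentSpace I : M → Type _)⟯) :
    ContMDiffOn I (I.prod 𝓘(ℝ, F)) ∞
      (fun y => TotalSpace.mk' F y (localDeriv e ψ y (X y))) e.baseSet :=
  (contMDiffOn_trivialization_symm e e.open_baseSet subset_rfl
    (contMDiffOn_mvfderiv_apply e.open_baseSet (contMDiffOn_snd_trivialization ψ) X)).congr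
    fun _ hy => congrArg (TotalSpace.mk' F _) (e.symmL_apply hy _)

-- Flat derivatives in local trivializations are glued with a partition of unity. The weights sum to
-- one, so the terms `df(v) ψ` add up to exactly one copy and the Leibniz rule survives.
variable (I F E) in
theorem LinearConnection.nonempty [FiniteDimensional ℝ EB] [T2Space M] [SigmaCompactSpace M] :
    Nonempty (LinearConnection I F E) := by
  obtain ⟨ρ, hρ⟩ := SmoothPartitionOfUnity.exists_isSubordinate I (isClosed_univ (X := M))
    (fun i : M => (trivializationAt F E i).baseSet) (fun i => (trivializationAt F E i).open_baseSet)
    fun x _ => mem_iUnion.2 ⟨x, mem_baseSet_trivializationAt F E x⟩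
  have hbase : ∀ {x i}, i ∈ ρ.finsupport x → x ∈ (trivializationAt F E i).baseSet :=
    fun {x i} hi => hρ i (subset_tsupport _ ((ρ.mem_finsupport x).1 hi))
  have hone : ∀ x, ∑ i ∈ ρ.finsupport x, ρ i x = 1 := fun x => ρ.sum_finsupport x (mem_univ x)
  refine ⟨⟨fun ψ x => ∑ i ∈ ρ.finsupport x, ρ i x • localDeriv (trivializationAt F E i) ψ x,
    fun ψ ψ' x => ?_, fun f ψ x v => ?_, fun ψ X => ?_⟩⟩
  · rw [← Finset.sum_add_distrib]
    refine Finset.sum_congr rfl fun i hi => ?_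
    rw [localDeriv_add ψ ψ' (hbase hi), smul_add]
  · have h : ∀ i ∈ ρ.finsupport x,
        (ρ i x • localDeriv (trivializationAt F E i) (funSmul f ψ) x) v =
          f x • (ρ i x • localDeriv (trivializationAt F E i) ψ x) v +
            ρ i x • (mvfderiv I f x v • ψ x) := fun i hi => by
      rw [LinearMap.smul_apply, localDeriv_funSmul f ψ (hbase hi), smul_add, LinearMap.smul_apply,
        smul_comm]
    rw [LinearMap.sum_apply, Finset.sum_congr rfl h, Finset.sum_add_distrib, ← Finset.smul_sum,
      ← Finset.sum_smul, hone, one_smul, LinearMap.sum_apply]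
  -- The index set `ρ.finsupport y` varies with `y`; smoothness is proved for the locally finite sum
  -- over all indices, which has the same value.
  · have hs : ContMDiff I (I.prod 𝓘(ℝ, F)) ∞ (fun y => TotalSpace.mk' F y
        (∑ᶠ i, ρ i y • localDeriv (trivializationAt F E i) ψ y (X y))) := by
      refine ContMDiff.finsum_section_of_locallyFinite ?_ fun i => ?_
      · refine ρ.locallyFinite.subset fun i y hy h0 => hy ?_
        rw [show ρ i y = 0 from h0, zero_smul]
      · exact (ρ i).contMDiff.contMDiffOn.smul_section_of_tsupport
          (trivializationAt F E i).open_baseSet (hρ i) (contMDiffOn_localDeriv ψ X)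
    convert hs using 3 with y
    rw [LinearMap.sum_apply]
    refine (finsum_eq_sum_of_support_subset _ fun i hi => ?_).symm
    rw [ρ.coe_finsupport]
    intro h0
    exact hi (by simp only [show ρ i y = 0 from h0, zero_smul]; rfl)

end Connection

/-! ### Operators linear over functions are bundle endomorphisms -/

section Tensorial

variable {EB : Type*} [NormedAddCommGroup EB] [NormedSpace ℝ EB]
  {H : Type*} [TopologicalSpace H] {I : ModelWithCorners ℝ EB H}
  {M : Type*} [TopologicalSpace M] [ChartedSpace H M]
  {F : Type*} [NormedAddCommGroup F] [NormedSpace ℝ F]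
  {E : M → Type*} [TopologicalSpace (TotalSpace F E)]
  [∀ x, TopologicalSpace (E x)] [∀ x, AddCommGroup (E x)] [∀ x, Module ℝ (E x)]
  [FiberBundle F E] [VectorBundle ℝ F E]

/-- A map into a space of operators with finite-dimensional source is smooth once its values on
a basis are. -/
theorem contMDiffAt_clm_of_basis {V W ι : Type*} [NormedAddCommGroup V] [NormedSpace ℝ V]
    [FiniteDimensional ℝ V] [NormedAddCommGroup W] [NormedSpace ℝ W] [Fintype ι]
    (b : Module.Basis ι ℝ V) {A : M → V →L[ℝ] W} {x : M}
    (hA : ∀ i, ContMDiffAt I 𝓘(ℝ, W) ∞ (fun y => A y (b i)) x) :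
    ContMDiffAt I 𝓘(ℝ, V →L[ℝ] W) ∞ A x := by
  have h : A = fun y => ∑ i, ContinuousLinearMap.smulRightL ℝ V W
      (b.coord i).toContinuousLinearMap (A y (b i)) := by
    ext y v
    conv_lhs => rw [← b.sum_repr v, map_sum]
    rw [sum_apply]
    refine Finset.sum_congr rfl fun i _ => ?_
    rw [map_smul]
    rfl
  rw [h]
  refine contMDiffAt_finsetSum fun i _ => ?_
  exact (ContinuousLinearMap.contDiff _).contMDiff.contMDiffAt.comp x (hA i)

variable [FiniteDimensional ℝ EB] [IsManifold I ∞ M] [T2Space M]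
  {T : Cₛ^∞⟮I; F, E⟯ →ₗ[ℝ] Cₛ^∞⟮I; F, E⟯}

/-- An operator linear over the smooth functions is local. -/
theorem apply_eq_of_eventuallyEq (hT : ∀ (f : C^∞⟮I, M; ℝ⟯) ψ, T (funSmul f ψ) = funSmul f (T ψ))
    {ψ ψ' : Cₛ^∞⟮I; F, E⟯} {x : M} (h : ∀ᶠ y in 𝓝 x, ψ y = ψ' y) : T ψ x = T ψ' x := by
  obtain ⟨χ, h1, hs⟩ := exists_contMDiffMap_eventually_one I h
  have h0 : funSmul χ ψ = funSmul χ ψ' := by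
    ext y
    rw [funSmul_apply, funSmul_apply]
    by_cases hy : y ∈ tsupport χ
    · rw [show ψ y = ψ' y from hs hy]
    · rw [image_eq_zero_of_notMem_tsupport hy, zero_smul, zero_smul]
  have h2 := congrArg (fun s => T s x) h0
  simpa only [hT, funSmul_apply, h1.self_of_nhds, one_smul] using h2

variable [FiniteDimensional ℝ F] [ContMDiffVectorBundle ∞ F E I]

/-- Near `x` the difference `ψ - ψ'` is a combination of frame sections whose coefficients vanish at
`x`, and `T` lets the coefficients through. -/
theorem apply_eq_of_apply_eq (hT : ∀ (f : C^∞⟮I, M; ℝ⟯) ψ, T (funSmul f ψ) = funSmul f (T ψ))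
    {ψ ψ' : Cₛ^∞⟮I; F, E⟯} {x : M} (h : ψ x = ψ' x) : T ψ x = T ψ' x := by
  obtain ⟨s, hs⟩ := exists_frame (I := I) (F := F) (E := E) x
  obtain ⟨c, hc, hc0⟩ := hs (ψ - ψ')
  have h1 : T (ψ - ψ') x = 0 := by
    rw [apply_eq_of_eventuallyEq hT hc, map_sum, ContMDiffSection.sum_apply]
    refine Finset.sum_eq_zero fun i _ => ?_
    rw [hT, funSmul_apply, hc0 (sub_eq_zero.2 h), zero_smul]
  rw [map_sub] at h1
  exact sub_eq_zero.1 h1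

/-- An operator linear over the smooth functions is given by a smooth section of the endomorphism
bundle. -/
theorem exists_endomorphism_section [∀ x, IsTopologicalAddGroup (E x)]
    [∀ x, ContinuousSMul ℝ (E x)]
    (hT : ∀ (f : C^∞⟮I, M; ℝ⟯) ψ, T (funSmul f ψ) = funSmul f (T ψ)) :
    ∃ u : Cₛ^∞⟮I; F →L[ℝ] F, fun x => E x →L[ℝ] E x⟯, ∀ ψ x, T ψ x = u x (ψ x) := by
  choose s hs using fun (x : M) (v : E x) => exists_section_apply_eq (I := I) (F := F) x v
  let L : ∀ x, E x →ₗ[ℝ] E x := fun x =>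
    { toFun := fun v => T (s x v) x
      map_add' := fun v w => by
        rw [apply_eq_of_apply_eq hT (ψ := s x (v + w)) (ψ' := s x v + s x w) (x := x), map_add]
        · rfl
        · exact (hs x _).trans (congrArg₂ (· + ·) (hs x v).symm (hs x w).symm)
      map_smul' := fun r v => by
        rw [apply_eq_of_apply_eq hT (ψ := s x (r • v)) (ψ' := r • s x v) (x := x), map_smul]
        · rfl
        · exact (hs x _).trans (congrArg (r • ·) (hs x v).symm) }
  have hL : ∀ ψ x, T ψ x = L x (ψ x) := fun ψ x => apply_eq_of_apply_eq hT (hs x _).symm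
  let eq : ∀ x, E x ≃L[ℝ] F := fun x => (trivializationAt F E x).continuousLinearEquivAt ℝ x
    (mem_baseSet_trivializationAt F E x)
  have hcont : ∀ x, Continuous (L x) := fun x => by
    have h1 := (L x ∘ₗ (eq x).symm.toLinearEquiv.toLinearMap).continuous_of_finiteDimensional
    convert h1.comp (eq x).continuous with v
    ext v
    simp
  let u : ∀ x, E x →L[ℝ] E x := fun x => ⟨L x, hcont x⟩
  refine ⟨⟨u, fun x => ?_⟩, hL⟩
  rw [contMDiffAt_hom_bundle]
  refine ⟨contMDiffAt_id, ?_⟩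
  let b := Module.finBasis ℝ F
  set e := trivializationAt F E x
  have hx : x ∈ e.baseSet := mem_baseSet_trivializationAt F E x
  refine contMDiffAt_clm_of_basis b fun i => ?_
  -- With `σ` of constant coordinates `b i` near `x`, the coordinates of `T σ` are the `i`-th column
  -- of the matrix of `u`.
  obtain ⟨σ, hσ⟩ := exists_section_eventuallyEq (e.open_baseSet.mem_nhds hx)
    (contMDiffOn_trivialization_symm (I := I) e e.open_baseSet subset_rfl
      (contMDiffOn_const (c := b i)))
  have h2 := (e.contMDiffAt_section_iff hx).1 (T σ).contMDiff.contMDiffAt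
  refine h2.congr_of_eventuallyEq ?_
  filter_upwards [hσ, e.open_baseSet.mem_nhds hx] with y hy hye
  change e.continuousLinearMapAt ℝ y (L y (e.symmL ℝ y (b i))) = (e ⟨y, T σ y⟩).2
  rw [hL, hy, e.symmL_apply hye]
  exact congrFun (e.coe_linearMapAt_of_mem (R := ℝ) hye) _

end Tensorial

/-! ### Vector fields as derivations -/

section VectorFields

variable {EB : Type*} [NormedAddCommGroup EB] [NormedSpace ℝ EB] [FiniteDimensional ℝ EB]
  {H : Type*} [TopologicalSpace H] {I : ModelWithCorners ℝ EB H}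
  {M : Type*} [TopologicalSpace M] [ChartedSpace H M] [IsManifold I ∞ M]

/-- The Lie bracket of smooth vector fields, as a smooth vector field. -/
def vectorFieldBracket (X Y : Cₛ^∞⟮I; EB, (TangentSpace I : M → Type _)⟯) :
    Cₛ^∞⟮I; EB, (TangentSpace I : M → Type _)⟯ where
  toFun := VectorField.mlieBracket I X Y
  contMDiff_toFun := by
    have := FiniteDimensional.complete ℝ EB
    have : IsManifold I (((⊤ : ℕ∞) : WithTop ℕ∞) + 1) M := by simpa
    have : IsManifold I (minSmoothness ℝ 3) M :=
      .of_le (n := ∞) (by rw [minSmoothness_of_isRCLikeNormedField]; exact ENat.LEInfty.out)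
    exact fun x => ContMDiffAt.mlieBracket_vectorField (m := ⊤) (n := ⊤) X.contMDiff.contMDiffAt
      Y.contMDiff.contMDiffAt (by rw [minSmoothness_of_isRCLikeNormedField]; simp)

theorem vectorFieldBracket_add (X Y Z : Cₛ^∞⟮I; EB, (TangentSpace I : M → Type _)⟯) :
    vectorFieldBracket X (Y + Z) = vectorFieldBracket X Y + vectorFieldBracket X Z := by
  have := FiniteDimensional.complete ℝ EB
  ext x : 1
  exact VectorField.mlieBracket_add_right Y.mdifferentiableAt Z.mdifferentiableAt

theorem vectorFieldBracket_funSmul (X Y : Cₛ^∞⟮I; EB, (TangentSpace I : M → Type _)⟯)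
    (f : C^∞⟮I, M; ℝ⟯) : vectorFieldBracket X (funSmul f Y) =
      funSmul (vectorFieldDeriv X f) Y + funSmul f (vectorFieldBracket X Y) := by
  have := FiniteDimensional.complete ℝ EB
  ext x : 1
  exact VectorField.mlieBracket_smul_right f.mdifferentiableAt Y.mdifferentiableAt

theorem vectorFieldBracket_jacobi (X Y Z : Cₛ^∞⟮I; EB, (TangentSpace I : M → Type _)⟯) :
    vectorFieldBracket X (vectorFieldBracket Y Z) =
      vectorFieldBracket (vectorFieldBracket X Y) Z +
        vectorFieldBracket Y (vectorFieldBracket X Z) := by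
  have := FiniteDimensional.complete ℝ EB
  have h3 : IsManifold I (minSmoothness ℝ 3) M :=
    .of_le (n := ∞) (by rw [minSmoothness_of_isRCLikeNormedField]; exact ENat.LEInfty.out)
  have h2 : minSmoothness ℝ 2 ≤ ∞ := by
    rw [minSmoothness_of_isRCLikeNormedField]; exact ENat.LEInfty.out
  ext x : 1
  exact VectorField.leibniz_identity_mlieBracket_apply (X.contMDiff.contMDiffAt.of_le h2)
    (Y.contMDiff.contMDiffAt.of_le h2) (Z.contMDiff.contMDiffAt.of_le h2)

variable [T2Space M]

/-- The Lie bracket of vector fields acts on functions as the commutator of derivations. -/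
theorem vectorFieldDeriv_bracket (X Y : Cₛ^∞⟮I; EB, (TangentSpace I : M → Type _)⟯)
    (f : C^∞⟮I, M; ℝ⟯) (x : M) : vectorFieldDeriv (vectorFieldBracket X Y) f x =
      vectorFieldDeriv X (vectorFieldDeriv Y f) x - vectorFieldDeriv Y (vectorFieldDeriv X f) x := by
  rcases subsingleton_or_nontrivial EB with hEB | hEB
  · have h : ∀ (g : C^∞⟮I, M; ℝ⟯) (Z : Cₛ^∞⟮I; EB, (TangentSpace I : M → Type _)⟯),
        vectorFieldDeriv Z g x = 0 := fun g Z => by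
      change mvfderiv I g x (Z x) = 0
      have hZ : Z x = 0 := Subsingleton.elim (α := EB) _ _
      rw [hZ, map_zero]
    rw [h, h, h, sub_zero]
  obtain ⟨W, hW⟩ := exists_section_ne_zero (I := I) (F := EB) (E := (TangentSpace I : M → Type _)) x
  -- Expanding the Jacobi identity for `X`, `Y`, `fW` and cancelling `f` times the one for `X`, `Y`,
  -- `W` leaves `([X,Y]f - X(Yf) + Y(Xf)) W = 0`, and `W` is nonzero at `x`.
  have h1 := vectorFieldBracket_jacobi X Y (funSmul f W)
  have h2 := vectorFieldBracket_jacobi X Y W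
  simp only [vectorFieldBracket_funSmul, vectorFieldBracket_add, h2] at h1
  have h3 := congrArg (fun s => s x) h1
  simp only [ContMDiffSection.coe_add, Pi.add_apply, funSmul_apply, smul_add] at h3
  have h4 : (vectorFieldDeriv (vectorFieldBracket X Y) f x -
      (vectorFieldDeriv X (vectorFieldDeriv Y f) x - vectorFieldDeriv Y (vectorFieldDeriv X f) x)) •
        W x = 0 := by
    rw [sub_smul, sub_smul]
    rw [← sub_eq_zero] at h3
    rw [← neg_eq_zero, ← h3]
    abel
  exact sub_eq_zero.1 ((smul_eq_zero.1 h4).resolve_right hW)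

/-- Smooth functions separate tangent vectors. -/
theorem eq_of_forall_mvfderiv_eq [I.Boundaryless] {x : M} {v w : TangentSpace I x}
    (h : ∀ f : C^∞⟮I, M; ℝ⟯, mvfderiv I f x v = mvfderiv I f x w) : v = w := by
  let b := Module.finBasis ℝ EB
  obtain ⟨c, hc⟩ := exists_coordinates I b x
  have key : ∀ i (z : TangentSpace I x), mvfderiv I (c i) x z = b.coord i (z : EB) := by
    intro i z
    let ℓ : EB → ℝ := fun z => b.coord i (z - extChartAt I x x)
    have hℓ : ∀ y, HasFDerivAt ℓ (b.coord i).toContinuousLinearMap y := fun y =>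
      (b.coord i).toContinuousLinearMap.hasFDerivAt.comp y ((hasFDerivAt_id _).sub_const _)
    have hm : mfderiv I 𝓘(ℝ, ℝ) (c i) x = (b.coord i).toContinuousLinearMap := by
      rw [((c i).mdifferentiableAt (x := x)).mfderiv, I.range_eq_univ, fderivWithin_univ]
      refine (Filter.EventuallyEq.fderiv_eq ?_).trans (hℓ _).fderiv
      filter_upwards [extChartAt_target_mem_nhds (I := I) x,
        (continuousAt_extChartAt_symm (I := I) x).eventually
          (by rw [extChartAt_to_inv]; exact hc i)] with y hy hcy
      exact hcy.trans (by rw [(extChartAt I x).right_inv hy])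
    change mfderiv I 𝓘(ℝ, ℝ) (c i) x z = _
    rw [hm]
    rfl
  refine b.ext_elem (x := (v : EB)) fun i => ?_
  exact (key i v).symm.trans ((h (c i)).trans (key i w))

end VectorFields

/-! ### Direct sums of vector bundles -/

section ProductBundle

variable {EB : Type*} [NormedAddCommGroup EB] [NormedSpace ℝ EB]
  {H : Type*} [TopologicalSpace H] (I : ModelWithCorners ℝ EB H)
  {M : Type*} [TopologicalSpace M] [ChartedSpace H M] [IsManifold I ∞ M]
  (F₁ : Type*) [NormedAddCommGroup F₁] [NormedSpace ℝ F₁]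
  (E₁ : M → Type*) [TopologicalSpace (TotalSpace F₁ E₁)]
  [∀ x, TopologicalSpace (E₁ x)] [∀ x, AddCommGroup (E₁ x)] [∀ x, Module ℝ (E₁ x)]
  [FiberBundle F₁ E₁] [VectorBundle ℝ F₁ E₁] [ContMDiffVectorBundle ∞ F₁ E₁ I]
  (F₂ : Type*) [NormedAddCommGroup F₂] [NormedSpace ℝ F₂]
  (E₂ : M → Type*) [TopologicalSpace (TotalSpace F₂ E₂)]
  [∀ x, TopologicalSpace (E₂ x)] [∀ x, AddCommGroup (E₂ x)] [∀ x, Module ℝ (E₂ x)]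
  [FiberBundle F₂ E₂] [VectorBundle ℝ F₂ E₂] [ContMDiffVectorBundle ∞ F₂ E₂ I]

namespace VectorBundleHom

/-- The first projection of a direct sum of vector bundles. -/
def fst : VectorBundleHom I (F₁ × F₂) (E₁ ×ᵇ E₂) F₁ E₁ where
  fiberMap x := LinearMap.fst ℝ (E₁ x) (E₂ x)
  smooth p := contMDiffAt_totalSpace.2 ⟨contMDiffAt_proj _,
    (contDiff_fst (𝕜 := ℝ) (E := F₁) (F := F₂)).contMDiff.contMDiffAt.comp p
      (contMDiffAt_totalSpace.1 (contMDiffAt_id (x := p))).2⟩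

/-- The second projection of a direct sum of vector bundles. -/
def snd : VectorBundleHom I (F₁ × F₂) (E₁ ×ᵇ E₂) F₂ E₂ where
  fiberMap x := LinearMap.snd ℝ (E₁ x) (E₂ x)
  smooth p := contMDiffAt_totalSpace.2 ⟨contMDiffAt_proj _,
    (contDiff_snd (𝕜 := ℝ) (E := F₁) (F := F₂)).contMDiff.contMDiffAt.comp p
      (contMDiffAt_totalSpace.1 (contMDiffAt_id (x := p))).2⟩

/-- The second inclusion into a direct sum of vector bundles. -/
def inr : VectorBundleHom I F₂ E₂ (F₁ × F₂) (E₁ ×ᵇ E₂) where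
  fiberMap x := LinearMap.inr ℝ (E₁ x) (E₂ x)
  smooth p := contMDiffAt_totalSpace.2 ⟨contMDiffAt_proj _,
    (contMDiffAt_totalSpace.1 (((contMDiff_zeroSection ℝ E₁).comp
      (contMDiff_proj E₂)).contMDiffAt (x := p))).2.prodMk_space
      (contMDiffAt_totalSpace.1 (contMDiffAt_id (x := p))).2⟩

end VectorBundleHom

variable {I F₁ E₁ F₂ E₂}

/-- The section of a direct sum with given components. -/
def prodSection (s : Cₛ^∞⟮I; F₁, E₁⟯) (t : Cₛ^∞⟮I; F₂, E₂⟯) : Cₛ^∞⟮I; F₁ × F₂, E₁ ×ᵇ E₂⟯ where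
  toFun x := (s x, t x)
  contMDiff_toFun x := (contMDiffAt_section x).2
    (((contMDiffAt_section x).1 s.contMDiff.contMDiffAt).prodMk_space
      ((contMDiffAt_section x).1 t.contMDiff.contMDiffAt))

end ProductBundle

/-! ### Algebra of derivative endomorphisms and their symbols -/

section DerivativeEndomorphisms

variable {EB : Type*} [NormedAddCommGroup EB] [NormedSpace ℝ EB]
  {H : Type*} [TopologicalSpace H] {I : ModelWithCorners ℝ EB H}
  {M : Type*} [TopologicalSpace M] [ChartedSpace H M]
  {F : Type*} [NormedAddCommGroup F] [NormedSpace ℝ F]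
  {E : M → Type*} [TopologicalSpace (TotalSpace F E)]
  [∀ x, TopologicalSpace (E x)] [∀ x, AddCommGroup (E x)] [∀ x, Module ℝ (E x)]
  [FiberBundle F E] [VectorBundle ℝ F E]
  {D D' : Cₛ^∞⟮I; F, E⟯ →ₗ[ℝ] Cₛ^∞⟮I; F, E⟯}
  {DM DM' : C^∞⟮I, M; ℝ⟯ →ₗ[ℝ] C^∞⟮I, M; ℝ⟯}

theorem IsDerivativeOver.apply (h : IsDerivativeOver D DM) (f : C^∞⟮I, M; ℝ⟯)
    (ψ : Cₛ^∞⟮I; F, E⟯) (x : M) : D (funSmul f ψ) x = f x • D ψ x + DM f x • ψ x :=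
  congrArg (fun s => s x) (h f ψ)

theorem IsDerivativeOver.funCommutator_apply (h : IsDerivativeOver D DM) (f : C^∞⟮I, M; ℝ⟯)
    (ψ : Cₛ^∞⟮I; F, E⟯) : funCommutator D f ψ = funSmul (DM f) ψ := by
  rw [funCommutator, h f ψ, add_sub_cancel_left]

theorem IsDerivativeOver.commutator (h : IsDerivativeOver D DM) (h' : IsDerivativeOver D' DM') :
    IsDerivativeOver (D ∘ₗ D' - D' ∘ₗ D) (DM ∘ₗ DM' - DM' ∘ₗ DM) := by
  intro f ψ
  ext x
  change D (D' (funSmul f ψ)) x - D' (D (funSmul f ψ)) x =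
    f x • (D (D' ψ) x - D' (D ψ) x) + (DM (DM' f) x - DM' (DM f) x) • ψ x
  rw [h' f ψ, h f ψ, map_add, map_add]
  change D (funSmul f (D' ψ)) x + D (funSmul (DM' f) ψ) x -
    (D' (funSmul f (D ψ)) x + D' (funSmul (DM f) ψ) x) = _
  rw [h.apply, h.apply, h'.apply, h'.apply, smul_sub, sub_smul]
  abel

variable [FiniteDimensional ℝ EB] [IsManifold I ∞ M] [T2Space M] [Nontrivial F]
  [ContMDiffVectorBundle ∞ F E I]

theorem IsDerivativeOver.unique (h : IsDerivativeOver D DM) (h' : IsDerivativeOver D DM') :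
    DM = DM' := by
  ext f x
  obtain ⟨ψ, hψ⟩ := exists_section_ne_zero (I := I) (F := F) (E := E) x
  have h1 := (h.apply f ψ x).symm.trans (h'.apply f ψ x)
  exact smul_left_injective ℝ hψ (add_left_cancel h1)

/-- Compare `D((fg)ψ)` with `D(f(gψ))` at a point where `ψ` does not vanish. -/
theorem IsDerivativeOver.isLeibniz (h : IsDerivativeOver D DM) : IsLeibniz DM := by
  intro f g x
  obtain ⟨ψ, hψ⟩ := exists_section_ne_zero (I := I) (F := F) (E := E) x
  have h1 := h.apply (f * g) ψ x
  have h2 : funSmul (f * g) ψ = funSmul f (funSmul g ψ) := by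
    ext y
    exact mul_smul _ _ _
  rw [h2, h.apply, h.apply, funSmul_apply, smul_add, smul_smul, add_assoc] at h1
  have h3 : (f * g) x = f x * g x := rfl
  rw [h3, smul_smul, smul_smul, ← add_smul] at h1
  have h4 := smul_left_injective ℝ hψ (add_left_cancel h1)
  change DM (f * g) x = _
  rw [← h4]
  ring

/-- Derivative endomorphisms are the first order operators with scalar symbol. -/
theorem isDerivativeEndomorphism_iff (D : Cₛ^∞⟮I; F, E⟯ →ₗ[ℝ] Cₛ^∞⟮I; F, E⟯) :
    IsDerivativeEndomorphism D ↔ IsFirstOrderDiffOp D ∧ HasScalarSymbol D := by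
  constructor
  · rintro ⟨DM, h⟩
    refine ⟨fun f g ψ => ?_, fun f x => ⟨DM f x, fun ψ => ?_⟩⟩
    · rw [funCommutator, h.funCommutator_apply, h.funCommutator_apply]
      ext x
      change DM f x • g x • ψ x - g x • DM f x • ψ x = 0
      rw [smul_comm, sub_self]
    · rw [h.funCommutator_apply]
      rfl
  · rintro ⟨-, h⟩
    choose c hc using h
    have huniq : ∀ {r s : ℝ} {x : M}, (∀ ψ : Cₛ^∞⟮I; F, E⟯, r • ψ x = s • ψ x) → r = s := by
      intro r s x hrs
      obtain ⟨ψ, hψ⟩ := exists_section_ne_zero (I := I) (F := F) (E := E) x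
      exact smul_left_injective ℝ hψ (hrs ψ)
    have hsmooth : ∀ f, ContMDiff I 𝓘(ℝ, ℝ) ∞ (c f) := by
      intro f x
      obtain ⟨ψ, hψ⟩ := exists_section_ne_zero (I := I) (F := F) (E := E) x
      set e := trivializationAt F E x
      have hx : x ∈ e.baseSet := mem_baseSet_trivializationAt F E x
      have hne : (e ⟨x, ψ x⟩).2 ≠ 0 := fun h0 =>
        hψ ((e.continuousLinearEquivAt ℝ x hx).map_eq_zero_iff.1 h0)
      -- A functional `ℓ` nonzero on the coordinates of `ψ x` exhibits the scalar symbol near `x` as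
      -- the smooth quotient `ℓ([D,f]ψ) / ℓ(ψ)`.
      obtain ⟨ℓ, hℓ⟩ := exists_dual_vector ℝ _ (norm_ne_zero_iff.2 hne)
      have hp : ∀ s : Cₛ^∞⟮I; F, E⟯, ContMDiffAt I 𝓘(ℝ, ℝ) ∞ (fun y => ℓ (e ⟨y, s y⟩).2) x :=
        fun s => ℓ.contDiff.contMDiff.contMDiffAt.comp x
          ((e.contMDiffAt_section_iff hx).1 s.contMDiff.contMDiffAt)
      have h0 : ℓ (e ⟨x, ψ x⟩).2 ≠ 0 := by
        rw [hℓ.2]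
        simpa using hne
      refine ((hp (funCommutator D f ψ)).div₀ (hp ψ) h0).congr_of_eventuallyEq ?_
      filter_upwards [e.open_baseSet.mem_nhds hx, (hp ψ).continuousAt.eventually_ne h0] with y hy hy0
      have h1 : (e ⟨y, c f y • ψ y⟩).2 = c f y • (e ⟨y, ψ y⟩).2 := (e.linear ℝ hy).map_smul _ _
      change c f y = ℓ (e ⟨y, funCommutator D f ψ y⟩).2 / ℓ (e ⟨y, ψ y⟩).2
      rw [hc f y ψ, h1, map_smul, smul_eq_mul, mul_div_cancel_right₀ _ hy0]
    have hadd : ∀ f g x, c (f + g) x = c f x + c g x := fun f g x => huniq (x := x) fun ψ => by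
      have h1 : funSmul (f + g) ψ = funSmul f ψ + funSmul g ψ := by
        ext y
        exact add_smul _ _ _
      have h2 : ∀ s : Cₛ^∞⟮I; F, E⟯, funSmul (f + g) s x = f x • s x + g x • s x := fun s => add_smul _ _ _
      rw [← hc, add_smul, ← hc, ← hc]
      simp only [funCommutator, h1, map_add, ContMDiffSection.coe_sub, ContMDiffSection.coe_add,
        Pi.sub_apply, Pi.add_apply, h2, funSmul_apply]
      abel
    have hsmul : ∀ (r : ℝ) f x, c (r • f) x = r * c f x := fun r f x => huniq (x := x) fun ψ => by
      have h1 : ∀ s : Cₛ^∞⟮I; F, E⟯, funSmul (r • f) s = r • funSmul f s := fun s => by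
        ext y
        exact smul_assoc r (f y) (s y)
      rw [← hc, mul_smul, ← hc]
      simp only [funCommutator, h1, map_smul, ← smul_sub]
      rfl
    refine ⟨{ toFun := fun f => ⟨c f, hsmooth f⟩, map_add' := fun f g => ?_,
              map_smul' := fun r f => ?_ }, fun f ψ => ?_⟩
    · ext x
      exact hadd f g x
    · ext x
      exact hsmul r f x
    · ext x
      have h1 := hc f x ψ
      change D (funSmul f ψ) x - f x • D ψ x = _ at h1
      exact (sub_eq_iff_eq_add'.1 h1)

end DerivativeEndomorphisms

/-! ### The Lie algebroid structure on `TM ⊕ End E` -/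

section Algebroid

variable {EB : Type*} [NormedAddCommGroup EB] [NormedSpace ℝ EB]
  {H : Type*} [TopologicalSpace H] {I : ModelWithCorners ℝ EB H}
  {M : Type*} [TopologicalSpace M] [ChartedSpace H M] [IsManifold I ∞ M]
  {F : Type*} [NormedAddCommGroup F] [NormedSpace ℝ F]
  {E : M → Type*} [TopologicalSpace (TotalSpace F E)]
  [∀ x, TopologicalSpace (E x)] [∀ x, AddCommGroup (E x)] [∀ x, Module ℝ (E x)]
  [∀ x, IsTopologicalAddGroup (E x)] [∀ x, ContinuousSMul ℝ (E x)]
  [FiberBundle F E] [VectorBundle ℝ F E]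

variable (I F E) in
/-- Smooth sections of the bundle of derivative endomorphisms, which a linear connection splits
into tangent vectors and endomorphisms. -/
abbrev DerivativeSection :=
  Cₛ^∞⟮I; EB × (F →L[ℝ] F), ((TangentSpace I : M → Type _) ×ᵇ fun x => E x →L[ℝ] E x)⟯

/-- The vector field underlying a section of the bundle of derivative endomorphisms. -/
def DerivativeSection.symbol (X : DerivativeSection I F E) :
    Cₛ^∞⟮I; EB, (TangentSpace I : M → Type _)⟯ :=
  (VectorBundleHom.fst I EB (TangentSpace I : M → Type _) (F →L[ℝ] F)
    (fun x => E x →L[ℝ] E x)).mapSection X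

/-- The endomorphism part of a section of the bundle of derivative endomorphisms. -/
def DerivativeSection.endo (X : DerivativeSection I F E) :
    Cₛ^∞⟮I; F →L[ℝ] F, fun x => E x →L[ℝ] E x⟯ :=
  (VectorBundleHom.snd I EB (TangentSpace I : M → Type _) (F →L[ℝ] F)
    (fun x => E x →L[ℝ] E x)).mapSection X

/-- The operator `∇_X + u` attached to a section `(X, u)`. -/
def LinearConnection.operator (cov : LinearConnection I F E) :
    DerivativeSection I F E →ₗ[ℝ] Cₛ^∞⟮I; F, E⟯ →ₗ[ℝ] Cₛ^∞⟮I; F, E⟯ :=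
  LinearMap.mk₂ ℝ
    (fun X ψ => ⟨fun x => cov.toFun ψ x (X.symbol x) + X.endo x (ψ x),
      (cov.contMDiff ψ X.symbol).add_section (X.endo.contMDiff.clm_bundle_apply ψ.contMDiff)⟩)
    (fun X Y ψ => by
      ext x
      have h := (cov.toFun ψ x).map_add (X.symbol x) (Y.symbol x)
      change cov.toFun ψ x (X.symbol x + Y.symbol x) + (X.endo x (ψ x) + Y.endo x (ψ x)) =
        (cov.toFun ψ x (X.symbol x) + X.endo x (ψ x)) +
          (cov.toFun ψ x (Y.symbol x) + Y.endo x (ψ x))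
      rw [h]
      abel)
    (fun r X ψ => by
      ext x
      have h := (cov.toFun ψ x).map_smul r (X.symbol x)
      change cov.toFun ψ x (r • X.symbol x) + r • X.endo x (ψ x) =
        r • (cov.toFun ψ x (X.symbol x) + X.endo x (ψ x))
      rw [h, smul_add])
    (fun X ψ ψ' => by
      ext x
      change cov.toFun (ψ + ψ') x (X.symbol x) + X.endo x (ψ x + ψ' x) =
        (cov.toFun ψ x (X.symbol x) + X.endo x (ψ x)) +
          (cov.toFun ψ' x (X.symbol x) + X.endo x (ψ' x))
      rw [cov.map_add, _root_.map_add, LinearMap.add_apply]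
      abel)
    (fun r X ψ => by
      ext x
      change cov.toFun (r • ψ) x (X.symbol x) + X.endo x (r • ψ x) =
        r • (cov.toFun ψ x (X.symbol x) + X.endo x (ψ x))
      rw [cov.map_smul, _root_.map_smul, LinearMap.smul_apply, smul_add])

theorem LinearConnection.operator_apply (cov : LinearConnection I F E)
    (X : DerivativeSection I F E) (ψ : Cₛ^∞⟮I; F, E⟯) (x : M) :
    cov.operator X ψ x = cov.toFun ψ x (X x).1 + (X x).2 (ψ x) := rfl

theorem LinearConnection.operator_funSmul (cov : LinearConnection I F E) (f : C^∞⟮I, M; ℝ⟯)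
    (X : DerivativeSection I F E) (ψ : Cₛ^∞⟮I; F, E⟯) :
    cov.operator (funSmul f X) ψ = funSmul f (cov.operator X ψ) := by
  ext x
  have h := (cov.toFun ψ x).map_smul (f x) (X x).1
  change cov.toFun ψ x (f x • (X x).1) + f x • (X x).2 (ψ x) =
    f x • (cov.toFun ψ x (X x).1 + (X x).2 (ψ x))
  rw [h, smul_add]

theorem LinearConnection.isDerivativeOver_operator (cov : LinearConnection I F E)
    (X : DerivativeSection I F E) :
    IsDerivativeOver (cov.operator X) (vectorFieldDeriv X.symbol) := by
  intro f ψ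
  ext x
  change cov.toFun (funSmul f ψ) x (X x).1 + (X x).2 (f x • ψ x) =
    f x • (cov.toFun ψ x (X x).1 + (X x).2 (ψ x)) + mvfderiv I f x (X x).1 • ψ x
  rw [cov.leibniz, _root_.map_smul, smul_add]
  abel

variable [FiniteDimensional ℝ EB] [T2Space M] [Nontrivial F] [I.Boundaryless]
  [ContMDiffVectorBundle ∞ F E I]

theorem LinearConnection.operator_injective (cov : LinearConnection I F E) :
    Function.Injective cov.operator := by
  intro X Y h
  have h1 : ∀ x, (X x).1 = (Y x).1 := fun x => eq_of_forall_mvfderiv_eq fun f => by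
    have h2 := cov.isDerivativeOver_operator X
    rw [h] at h2
    have h3 := h2.unique (cov.isDerivativeOver_operator Y)
    exact congrArg (fun d : C^∞⟮I, M; ℝ⟯ →ₗ[ℝ] C^∞⟮I, M; ℝ⟯ => d f x) h3
  ext x : 1
  refine Prod.ext (h1 x) (ContinuousLinearMap.ext fun v => ?_)
  obtain ⟨ψ, rfl⟩ := exists_section_apply_eq (I := I) (F := F) x v
  have h2 := congrArg (fun D : Cₛ^∞⟮I; F, E⟯ →ₗ[ℝ] Cₛ^∞⟮I; F, E⟯ => D ψ x) h
  simp only [cov.operator_apply, h1 x] at h2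
  exact add_left_cancel h2

variable [FiniteDimensional ℝ F]

theorem LinearConnection.isDerivativeEndomorphism_iff_exists (cov : LinearConnection I F E)
    (D : Cₛ^∞⟮I; F, E⟯ →ₗ[ℝ] Cₛ^∞⟮I; F, E⟯) :
    IsDerivativeEndomorphism D ↔ ∃ X, cov.operator X = D := by
  constructor
  · rintro ⟨DM, h⟩
    obtain ⟨X, hX⟩ := h.isLeibniz.exists_vectorField
    -- The operator of `Z` is `∇_X`. It has the same `D_M` as `D`, so the derivative terms cancel in
    -- the difference.
    let Z : DerivativeSection I F E := prodSection X 0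
    have hZ : vectorFieldDeriv Z.symbol = DM := by
      ext f x
      exact (hX f x).symm
    have hT : ∀ (f : C^∞⟮I, M; ℝ⟯) ψ,
        (D - cov.operator Z) (funSmul f ψ) = funSmul f ((D - cov.operator Z) ψ) := by
      intro f ψ
      have h2 := cov.isDerivativeOver_operator Z
      rw [hZ] at h2
      rw [LinearMap.sub_apply, LinearMap.sub_apply, h f ψ, h2 f ψ, add_sub_add_right_eq_sub]
      ext x
      exact (smul_sub _ _ _).symm
    obtain ⟨u, hu⟩ := exists_endomorphism_section hT
    refine ⟨prodSection X u, ?_⟩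
    ext ψ x
    have h3 := hu ψ x
    change D ψ x - (cov.toFun ψ x (X x) + (0 : E x →L[ℝ] E x) (ψ x)) = u x (ψ x) at h3
    rw [zero_apply, add_zero] at h3
    change cov.toFun ψ x (X x) + u x (ψ x) = D ψ x
    rw [← h3, add_sub_cancel]
  · rintro ⟨X, rfl⟩
    exact ⟨_, cov.isDerivativeOver_operator X⟩

/-- The commutator lies in the image of `cov.operator`, and injectivity makes its preimage unique,
hence bilinear in the two sections. -/
theorem LinearConnection.exists_bracket (cov : LinearConnection I F E) :
    ∃ B : DerivativeSection I F E →ₗ[ℝ] DerivativeSection I F E →ₗ[ℝ] DerivativeSection I F E,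
      ∀ X Y, cov.operator (B X Y) =
        cov.operator X ∘ₗ cov.operator Y - cov.operator Y ∘ₗ cov.operator X := by
  choose B hB using fun X Y => (cov.isDerivativeEndomorphism_iff_exists _).1
    ⟨_, (cov.isDerivativeOver_operator X).commutator (cov.isDerivativeOver_operator Y)⟩
  refine ⟨LinearMap.mk₂ ℝ B (fun X X' Y => ?_) (fun r X Y => ?_) (fun X Y Y' => ?_)
    (fun r X Y => ?_), hB⟩ <;> refine cov.operator_injective ?_
  · rw [_root_.map_add, hB, hB, hB, _root_.map_add, LinearMap.add_comp, LinearMap.comp_add]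
    abel
  · rw [_root_.map_smul, hB, hB, _root_.map_smul, LinearMap.smul_comp, LinearMap.comp_smul,
      smul_sub]
  · rw [_root_.map_add, hB, hB, hB, _root_.map_add, LinearMap.add_comp, LinearMap.comp_add]
    abel
  · rw [_root_.map_smul, hB, hB, _root_.map_smul, LinearMap.smul_comp, LinearMap.comp_smul,
      smul_sub]

/-- The bracket of sections corresponding to the commutator of operators. -/
def LinearConnection.bracket (cov : LinearConnection I F E) :
    DerivativeSection I F E →ₗ[ℝ] DerivativeSection I F E →ₗ[ℝ] DerivativeSection I F E :=
  cov.exists_bracket.choose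

theorem LinearConnection.operator_bracket (cov : LinearConnection I F E)
    (X Y : DerivativeSection I F E) : cov.operator (cov.bracket X Y) =
      cov.operator X ∘ₗ cov.operator Y - cov.operator Y ∘ₗ cov.operator X :=
  cov.exists_bracket.choose_spec X Y

/-- The Lie algebroid of derivative endomorphisms. -/
def LinearConnection.algebroid (cov : LinearConnection I F E) :
    LieAlgebroid I (EB × (F →L[ℝ] F))
      ((TangentSpace I : M → Type _) ×ᵇ fun x => E x →L[ℝ] E x) where
  anchor := VectorBundleHom.fst I EB (TangentSpace I : M → Type _) (F →L[ℝ] F)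
    (fun x => E x →L[ℝ] E x)
  bracket := cov.bracket
  bracket_self X := cov.operator_injective <| by
    rw [cov.operator_bracket, sub_self, map_zero]
  jacobi X Y Z := cov.operator_injective <| by
    rw [_root_.map_add, _root_.map_add, map_zero]
    simp only [cov.operator_bracket]
    ext ψ : 1
    simp only [LinearMap.add_apply, LinearMap.sub_apply, LinearMap.comp_apply, map_sub,
      LinearMap.zero_apply]
    abel
  anchor_bracket X Y x := by
    refine eq_of_forall_mvfderiv_eq fun f => ?_
    have h1 := cov.isDerivativeOver_operator (cov.bracket X Y)
    rw [cov.operator_bracket] at h1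
    -- The bracket's vector field and the commutator of the two derivations are both `D_M` of the
    -- same operator.
    have h2 := h1.unique
      ((cov.isDerivativeOver_operator X).commutator (cov.isDerivativeOver_operator Y))
    have h3 := congrArg (fun d : C^∞⟮I, M; ℝ⟯ →ₗ[ℝ] C^∞⟮I, M; ℝ⟯ => d f x) h2
    exact h3.trans (vectorFieldDeriv_bracket (DerivativeSection.symbol X)
      (DerivativeSection.symbol Y) f x).symm
  leibniz X Y f x := by
    have h : cov.bracket X (funSmul f Y) =
        funSmul f (cov.bracket X Y) +
          funSmul (vectorFieldDeriv (DerivativeSection.symbol X) f) Y := by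
      refine cov.operator_injective ?_
      rw [_root_.map_add, cov.operator_bracket]
      ext ψ : 1
      simp only [LinearMap.add_apply, LinearMap.sub_apply, LinearMap.comp_apply,
        cov.operator_funSmul, cov.operator_bracket]
      rw [cov.isDerivativeOver_operator X f]
      ext y
      simp only [ContMDiffSection.coe_sub, ContMDiffSection.coe_add, Pi.sub_apply, Pi.add_apply,
        funSmul_apply, smul_sub]
      abel
    rw [h]
    rfl

end Algebroid

end

theorem theorem1p3
    {EB : Type uB} [NormedAddCommGroup EB] [NormedSpace ℝ EB] [FiniteDimensional ℝ EB]
    {H : Type uH} [TopologicalSpace H] (I : ModelWithCorners ℝ EB H) [I.Boundaryless]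
    (M : Type uM) [TopologicalSpace M] [ChartedSpace H M] [IsManifold I ∞ M]
    [T2Space M] [SecondCountableTopology M]
    -- a smooth real vector bundle `E` over `M` of finite nonzero rank, with model fibre `F`
    (F : Type uF) [NormedAddCommGroup F] [NormedSpace ℝ F] [FiniteDimensional ℝ F] [Nontrivial F]
    (E : M → Type uE) [TopologicalSpace (Bundle.TotalSpace F E)]
    [∀ x, TopologicalSpace (E x)] [∀ x, AddCommGroup (E x)] [∀ x, Module ℝ (E x)]
    [∀ x, IsTopologicalAddGroup (E x)] [∀ x, ContinuousSMul ℝ (E x)]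
    [FiberBundle F E] [VectorBundle ℝ F E] [ContMDiffVectorBundle ∞ F E I] :
    -- derivative endomorphisms are the first-order operators with scalar symbol
    (∀ D : Cₛ^∞⟮I; F, E⟯ →ₗ[ℝ] Cₛ^∞⟮I; F, E⟯,
      IsDerivativeEndomorphism D ↔ IsFirstOrderDiffOp D ∧ HasScalarSymbol D) ∧
    -- there are a smooth vector bundle `A` of finite rank over `M`,
    ∃ (FA : Type (max uB uF)) (_ : NormedAddCommGroup FA) (_ : NormedSpace ℝ FA)
      (_ : FiniteDimensional ℝ FA)
      (A : M → Type (max uB uE)) (_ : TopologicalSpace (Bundle.TotalSpace FA A))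
      (_ : ∀ x, TopologicalSpace (A x)) (_ : ∀ x, AddCommGroup (A x)) (_ : ∀ x, Module ℝ (A x))
      (_ : FiberBundle FA A) (_ : VectorBundle ℝ FA A) (_ : ContMDiffVectorBundle ∞ FA A I)
      -- a Lie algebroid structure on it, an identification of its sections with operators on
      -- sections of `E`, and a vector bundle morphism from `End E` to `A`
      (L : LieAlgebroid I FA A)
      (Φ : Cₛ^∞⟮I; FA, A⟯ →ₗ[ℝ] (Cₛ^∞⟮I; F, E⟯ →ₗ[ℝ] Cₛ^∞⟮I; F, E⟯))
      (ι : VectorBundleHom I (F →L[ℝ] F) (fun x => E x →L[ℝ] E x) FA A),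
      -- the sections of `A` are exactly the derivative endomorphisms, as `C^∞(M)`-modules
      Function.Injective Φ ∧
      (∀ D, IsDerivativeEndomorphism D ↔ ∃ X, Φ X = D) ∧
      (∀ (f : C^∞⟮I, M; ℝ⟯) X ψ, Φ (funSmul f X) ψ = funSmul f (Φ X ψ)) ∧
      -- the bracket is the commutator
      (∀ X Y, Φ (L.bracket X Y) = Φ X ∘ₗ Φ Y - Φ Y ∘ₗ Φ X) ∧
      -- the anchor is `D ↦ D_M`
      (∀ X (DM : C^∞⟮I, M; ℝ⟯ →ₗ[ℝ] C^∞⟮I, M; ℝ⟯), IsDerivativeOver (Φ X) DM ↔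
        ∀ f x, DM f x = mvfderiv I f x (L.anchor.fiberMap x (X x))) ∧
      L.IsTransitive ∧
      -- the short exact sequence `End E → A → TM`, whose first arrow is the inclusion of the
      -- operators of order zero
      (∀ x, Function.Injective (ι.fiberMap x)) ∧
      (∀ x, Function.Exact (ι.fiberMap x) (L.anchor.fiberMap x)) ∧
      (∀ (u : Cₛ^∞⟮I; F →L[ℝ] F, fun x => E x →L[ℝ] E x⟯) (ψ : Cₛ^∞⟮I; F, E⟯) (x : M),
        Φ (ι.mapSection u) ψ x = u x (ψ x)) := by
  -- Local compactness and second countability give σ-compactness, needed for the partition of unity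
  -- behind the connection.
  have := Manifold.locallyCompact_of_finiteDimensional (M := M) I
  obtain ⟨cov⟩ := LinearConnection.nonempty I F E
  refine ⟨isDerivativeEndomorphism_iff, EB × (F →L[ℝ] F), inferInstance, inferInstance,
    inferInstance, ((TangentSpace I : M → Type _) ×ᵇ fun x => E x →L[ℝ] E x), inferInstance,
    inferInstance, inferInstance, inferInstance, inferInstance, inferInstance, inferInstance,
    cov.algebroid, cov.operator,
    VectorBundleHom.inr I EB (TangentSpace I : M → Type _) (F →L[ℝ] F) (fun x => E x →L[ℝ] E x),
    cov.operator_injective, cov.isDerivativeEndomorphism_iff_exists, cov.operator_funSmul,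
    cov.operator_bracket, fun X DM => ⟨fun h f x => ?_, fun h => ?_⟩,
    fun x v => ⟨(v, 0), rfl⟩, fun x => LinearMap.inr_injective, fun x => Function.Exact.inr_fst,
    fun u ψ x => ?_⟩
  · rw [h.unique (cov.isDerivativeOver_operator X)]
    rfl
  · have h1 : DM = vectorFieldDeriv (DerivativeSection.symbol X) := by
      ext f x
      exact h f x
    rw [h1]
    exact cov.isDerivativeOver_operator X
  · change cov.toFun ψ x 0 + u x (ψ x) = u x (ψ x)
    rw [map_zero, zero_add]
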